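/- Let $F$ be an unsatisfiable CNF formula on $n\ge 1$ variables, identified with the system of linear inequalities consisting of $x_i\ge 0$ and $-x_i\ge -1$ for every variable $x_i$, and $\sum_{i\in P}x_i+\sum_{i\in N}(1-x_i)\ge 1$ for every clause $\bigvee_{i\in P}x_i\vee\bigvee_{i\in N}\neg x_i$ of $F$. A Stabbing Planes (SP) refutation of $F$ is a finite binary tree in which every internal node carries a query $(ax\le b-1,\ ax\ge b)$ with $a\in\mathbb{Z}^n$, $b\in\mathbb{Z}$, the two inequalities labelling its left and right outgoing edges, and every leaf carries a non-negative rational linear combination of inequalities of $F$ and of inequalities on the path from the root to that leaf that yields $0\ge 1$. Its size is the bit-length of its description: one bit per node, plus the lengths in binary of the coefficients and right-hand sides of all queries (each with a sign bit) and of the positions and multipliers (numerator and denominator) of the inequalities listed at all leaves. A Cutting Planes (CP) refutation of $F$ is a sequence of integral linear inequalities ending in $0\ge 1$, each of which is an inequality of $F$, or a linear combination of two earlier ones with non-negative integer multipliers, or is $(a/d)x\ge\lceil b/d\rceil$ for an earlier line $ax\ge b$ and an integer $d\ge 1$ dividing all entries of $a$. Its size is the number of its lines. Suppose that $F$ has an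 SP refutation of size $s$ in which all entries of the vectors $a$ of the queries have absolute value at most $c$, where $c\ge 1$ is an integer. Then $F$ has a CP refutation of size at most $$s\,(cn)^{\log_2 s}.$$ Moreover, there is an absolute constant $K$ such that, if $\ell$ denotes the number of leaves of the SP refutation, the CP refutation can be chosen to have in addition at most $K\,n\cdot \ell\,(cn)^{\log_2 \ell}$ lines. -/

import Mathlib

/-- The integral linear inequality `∑ i, coeff i * x i ≥ rhs` in `n` variables. -/
structure LinIneq (n : ℕ) where
  coeff : Fin n → ℤ
  rhs : ℤ

/-- The inequality `0 ≥ 1`. -/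
def LinIneq.falsum (n : ℕ) : LinIneq n := ⟨0, 1⟩

/-! ### CNF formulas -/

/-- The clause `⋁ i ∈ pos, x i ∨ ⋁ i ∈ neg, ¬ x i`. -/
structure CNFClause (n : ℕ) where
  pos : Finset (Fin n)
  neg : Finset (Fin n)

/-- A CNF formula on `n` variables is a finite list of clauses. -/
abbrev CNFFormula (n : ℕ) := List (CNFClause n)

def CNFClause.SatisfiedBy {n : ℕ} (C : CNFClause n) (v : Fin n → Bool) : Prop :=
  (∃ i ∈ C.pos, v i = true) ∨ (∃ i ∈ C.neg, v i = false)

def CNFFormula.Unsatisfiable {n : ℕ} (F : CNFFormula n) : Prop :=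
  ¬ ∃ v : Fin n → Bool, ∀ C ∈ F, C.SatisfiedBy v

/-- `∑ i ∈ pos, x i + ∑ i ∈ neg, (1 - x i) ≥ 1`, with the constants moved to the right. -/
def CNFClause.toIneq {n : ℕ} (C : CNFClause n) : LinIneq n where
  coeff i := (if i ∈ C.pos then 1 else 0) - (if i ∈ C.neg then 1 else 0)
  rhs := 1 - (C.neg.card : ℤ)

/-- The translation of a CNF formula: `x i ≥ 0` and `-x i ≥ -1` for every variable, and one
inequality for every clause. -/
def CNFFormula.system {n : ℕ} (F : CNFFormula n) : List (LinIneq n) :=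
  (List.finRange n).map (fun i => ⟨Pi.single i 1, 0⟩) ++
  (List.finRange n).map (fun i => ⟨Pi.single i (-1), -1⟩) ++
  F.map CNFClause.toIneq

/-! ### Cutting Planes -/

/-- Linear combination: from `I` and `J` deduce `p * I + q * J`, with `p, q` natural numbers. -/
def LinIneq.IsLinComb {n : ℕ} (I J K : LinIneq n) : Prop :=
  ∃ p q : ℕ, (∀ i, K.coeff i = p * I.coeff i + q * J.coeff i) ∧ K.rhs = p * I.rhs + q * J.rhs

/-- Division rule: if the positive integer `d` divides all coefficients of `a x ≥ b`, deduce
`(a / d) x ≥ ⌈b / d⌉`. -/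
def LinIneq.IsDivision {n : ℕ} (I K : LinIneq n) : Prop :=
  ∃ d : ℕ, 0 < d ∧ (∀ i, I.coeff i = d * K.coeff i) ∧ K.rhs = ⌈(I.rhs : ℚ) / (d : ℚ)⌉

/-- `π` is a Cutting Planes proof from the system `S`: every line is in `S` or is deduced from
earlier lines. -/
def IsCPProof {n : ℕ} (S : List (LinIneq n)) (π : List (LinIneq n)) : Prop :=
  ∀ k : Fin π.length,
    π.get k ∈ S ∨
    (∃ i j : Fin π.length, i < k ∧ j < k ∧ (π.get i).IsLinComb (π.get j) (π.get k)) ∨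
    (∃ i : Fin π.length, i < k ∧ (π.get i).IsDivision (π.get k))

/-- A Cutting Planes refutation is a proof whose last line is `0 ≥ 1`. Its size is its number of
lines, `π.length`. -/
def IsCPRefutation {n : ℕ} (S : List (LinIneq n)) (π : List (LinIneq n)) : Prop :=
  IsCPProof S π ∧ π.getLast? = some (LinIneq.falsum n)

/-! ### Stabbing Planes -/

/-- The trees underlying Stabbing Planes refutations. An internal node is labelled by its query
`(a x ≤ b - 1, a x ≥ b)`. A leaf is labelled by a non-negative linear combination, written as a
list of pairs (position of an inequality in the system at this leaf, its multiplier). -/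
inductive SPTree (n : ℕ) where
  | leaf (comb : List (ℕ × ℚ≥0)) : SPTree n
  | query (a : Fin n → ℤ) (b : ℤ) (left right : SPTree n) : SPTree n

/-- The combination `comb` of inequalities of `S` is well-formed and yields `0 ≥ 1`. -/
def CombYieldsFalsum {n : ℕ} (S : List (LinIneq n)) (comb : List (ℕ × ℚ≥0)) : Prop :=
  (∀ t ∈ comb, t.1 < S.length) ∧
  (∀ i, (comb.map fun t => (t.2 : ℚ) * ((S.getD t.1 ⟨0, 0⟩).coeff i : ℚ)).sum = 0) ∧
  (comb.map fun t => (t.2 : ℚ) * ((S.getD t.1 ⟨0, 0⟩).rhs : ℚ)).sum = 1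

namespace SPTree

/-- `T.Refutes S`: the tree `T` is a Stabbing Planes refutation of the system `S`. The left edge of
a query adds `a x ≤ b - 1`, that is `-a x ≥ 1 - b`, and the right edge adds `a x ≥ b`. -/
def Refutes {n : ℕ} : SPTree n → List (LinIneq n) → Prop
  | leaf comb, S => CombYieldsFalsum S comb
  | query a b l r, S => l.Refutes (S ++ [⟨-a, 1 - b⟩]) ∧ r.Refutes (S ++ [⟨a, b⟩])

/-- Every coefficient of every query has absolute value at most `c`. -/
def CoeffBound {n : ℕ} (c : ℕ) : SPTree n → Prop
  | leaf _ => True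
  | query a _ l r => (∀ i, |a i| ≤ (c : ℤ)) ∧ l.CoeffBound c ∧ r.CoeffBound c

/-- Bit-length of an integer: a sign bit and the binary digits. -/
def intSize (z : ℤ) : ℕ := 1 + Nat.size z.natAbs

/-- The size of a tree: the bit-length of its description, with one bit per node (leaf or query),
the coefficients and right-hand side of every query, and the positions and multipliers (numerator
and denominator) at every leaf, all in binary. -/
def size {n : ℕ} : SPTree n → ℕ
  | leaf comb => 1 + (comb.map fun t => Nat.size t.1 + Nat.size t.2.num + Nat.size t.2.den).sum
  | query a b l r => 1 + (∑ i, intSize (a i)) + intSize b + l.size + r.size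

/-- The number of leaves, which is one more than the number of queries. -/
def numLeaves {n : ℕ} : SPTree n → ℕ
  | leaf _ => 1
  | query _ _ l r => l.numLeaves + r.numLeaves

end SPTree

/-! ### Weighted Cutting Planes derivations -/

/-! The idea is to turn branching into repeated rounding. Over the cube, `a x` has an integral
maximum `M`. Suppose that adding `a x ≥ b` gives a refutation, with `b ≤ M`. Replay that refutation
on the face `a x = M`: every line is corrected by a multiple of `a x ≥ M`, and the last one becomes
`-m a x ≥ 1 - m M`. Adding `a x ≤ M` and dividing by `m + 1` rounds this to `a x ≤ M - 1`. After at
most `c n` rounds `a x ≤ b - 1` is reached, and the refutation of the other side finishes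
(`CPExtends.lift`, `CPExtends.tighten`, `RefutableWithin.branch`).

The side repeated is the cheaper one. Replaying a division takes an extra line, so counting lines
would double the cost per replay, which is too much. Charging `2` for a division limits the growth
to `3 / 2`. With `m = c n` and `x ≤ y` the sizes of the two sides, the main terms are `3 / 2 * m * f
x + f y`, and `f s = s ^ (1 + logb 2 m)`, which equals `s * m ^ logb 2 s`, absorbs them if `m ≥ 2`
(`rpow_branch_le`). Additive terms are paid by the bits of the query in the first bound and by a
subtracted `8 n` in the second, where Carathéodory's theorem makes leaf costs linear in `n`. The
case `c n = 1` is done by hand. -/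

@[ext]
theorem LinIneq.ext_coeff_rhs {n : ℕ} {I J : LinIneq n} (hc : ∀ i, I.coeff i = J.coeff i)
    (hr : I.rhs = J.rhs) : I = J := by
  cases I; cases J
  simp only [LinIneq.mk.injEq]
  exact ⟨funext hc, hr⟩

/-- `CPExtends S Γ Δ w`: the Cutting Planes rules over the axioms `S` extend the set of lines `Γ`
(most recent line first) to `Δ`, at total cost `w`. A division costs `2`, any other line `1`. -/
inductive CPExtends {n : ℕ} (S : Set (LinIneq n)) (Γ : List (LinIneq n)) :
    List (LinIneq n) → ℕ → Prop
  | refl : CPExtends S Γ Γ 0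
  | hyp {Δ : List (LinIneq n)} {w : ℕ} {I : LinIneq n} :
      CPExtends S Γ Δ w → I ∈ S → CPExtends S Γ (I :: Δ) (w + 1)
  | comb {Δ : List (LinIneq n)} {w : ℕ} {I J K : LinIneq n} :
      CPExtends S Γ Δ w → I ∈ Δ → J ∈ Δ → I.IsLinComb J K → CPExtends S Γ (K :: Δ) (w + 1)
  | div {Δ : List (LinIneq n)} {w : ℕ} {I K : LinIneq n} :
      CPExtends S Γ Δ w → I ∈ Δ → I.IsDivision K → CPExtends S Γ (K :: Δ) (w + 2)

namespace CPExtends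

variable {n : ℕ} {S : Set (LinIneq n)} {Γ Δ Θ : List (LinIneq n)} {v w : ℕ}

theorem trans (h₁ : CPExtends S Γ Δ v) (h₂ : CPExtends S Δ Θ w) :
    CPExtends S Γ Θ (v + w) := by
  induction h₂ with
  | refl => exact h₁
  | hyp _ hI ih => exact ih.hyp hI
  | comb _ hI hJ hK ih => exact ih.comb hI hJ hK
  | div _ hI hK ih => exact ih.div hI hK

theorem subset (h : CPExtends S Γ Δ w) : Γ ⊆ Δ := by
  induction h with
  | refl => exact List.Subset.refl _
  | hyp _ _ ih => exact List.Subset.trans ih (List.subset_cons_self _ _)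
  | comb _ _ _ _ ih => exact List.Subset.trans ih (List.subset_cons_self _ _)
  | div _ _ _ ih => exact List.Subset.trans ih (List.subset_cons_self _ _)

theorem length_le (h : CPExtends S [] Δ w) : Δ.length ≤ w := by
  induction h with
  | refl => simp
  | hyp _ _ ih => simpa using ih
  | comb _ _ _ _ ih => simpa using ih
  | div _ _ _ ih => simp only [List.length_cons]; omega

/-- A line that has already been derived may serve as an axiom. -/
theorem cut {J : LinIneq n} {π : List (LinIneq n)} (h : CPExtends (insert J S) [] π w)
    (hJ : J ∈ Γ) : ∃ Δ, CPExtends S Γ Δ w ∧ π ⊆ Δ := by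
  induction h with
  | refl => exact ⟨Γ, .refl, List.nil_subset _⟩
  | @hyp _ _ I _ hI ih =>
    obtain ⟨Δ, hΔ, hsub⟩ := ih
    refine ⟨I :: Δ, ?_, List.cons_subset_cons _ hsub⟩
    rcases hI with rfl | hI
    -- The use of the axiom `J` becomes a copy `1 * J + 0 * J`, at the same cost.
    · exact hΔ.comb (hΔ.subset hJ) (hΔ.subset hJ) ⟨1, 0, by simp, by simp⟩
    · exact hΔ.hyp hI
  | comb _ hI hJ' hK ih =>
    obtain ⟨Δ, hΔ, hsub⟩ := ih
    exact ⟨_, hΔ.comb (hsub hI) (hsub hJ') hK, List.cons_subset_cons _ hsub⟩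
  | div _ hI hK ih =>
    obtain ⟨Δ, hΔ, hsub⟩ := ih
    exact ⟨_, hΔ.div (hsub hI) hK, List.cons_subset_cons _ hsub⟩

end CPExtends

theorem isCPProof_append_singleton {n : ℕ} {S π : List (LinIneq n)} {K : LinIneq n}
    (hπ : IsCPProof S π)
    (hK : K ∈ S ∨ (∃ I ∈ π, ∃ J ∈ π, I.IsLinComb J K) ∨ ∃ I ∈ π, I.IsDivision K) :
    IsCPProof S (π ++ [K]) := by
  have key : ∀ (k : ℕ) (hk : k < (π ++ [K]).length),
      (π ++ [K])[k] ∈ S ∨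
      (∃ (i j : ℕ) (hi : i < (π ++ [K]).length) (hj : j < (π ++ [K]).length), i < k ∧ j < k ∧
        ((π ++ [K])[i]).IsLinComb ((π ++ [K])[j]) ((π ++ [K])[k])) ∨
      (∃ (i : ℕ) (hi : i < (π ++ [K]).length), i < k ∧
        ((π ++ [K])[i]).IsDivision ((π ++ [K])[k])) := by
    intro k hk
    have hlen : (π ++ [K]).length = π.length + 1 := by simp
    rcases Nat.lt_or_ge k π.length with h | h
    · rw [List.getElem_append_left h]
      rcases hπ ⟨k, h⟩ with h1 | ⟨i, j, hi, hj, h1⟩ | ⟨i, hi, h1⟩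
      · exact .inl h1
      · refine .inr (.inl ⟨i, j, by omega, by omega, hi, hj, ?_⟩)
        rw [List.getElem_append_left i.2, List.getElem_append_left j.2]
        exact h1
      · refine .inr (.inr ⟨i, by omega, hi, ?_⟩)
        rw [List.getElem_append_left i.2]
        exact h1
    · obtain rfl : k = π.length := by omega
      rw [List.getElem_concat_length rfl]
      rcases hK with h1 | ⟨I, hI, J, hJ, h1⟩ | ⟨I, hI, h1⟩
      · exact .inl h1
      · obtain ⟨i, hi, rfl⟩ := List.getElem_of_mem hI
        obtain ⟨j, hj, rfl⟩ := List.getElem_of_mem hJ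
        refine .inr (.inl ⟨i, j, by omega, by omega, hi, hj, ?_⟩)
        rwa [List.getElem_append_left hi, List.getElem_append_left hj]
      · obtain ⟨i, hi, rfl⟩ := List.getElem_of_mem hI
        refine .inr (.inr ⟨i, by omega, hi, ?_⟩)
        rwa [List.getElem_append_left hi]
  intro k
  rcases key k k.2 with h1 | ⟨i, j, hi, hj, h1, h2, h3⟩ | ⟨i, hi, h1, h2⟩
  · exact .inl h1
  · exact .inr (.inl ⟨⟨i, hi⟩, ⟨j, hj⟩, h1, h2, h3⟩)
  · exact .inr (.inr ⟨⟨i, hi⟩, h1, h2⟩)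

theorem CPExtends.isCPProof_reverse {n : ℕ} {S : List (LinIneq n)} {Δ : List (LinIneq n)} {w : ℕ}
    (h : CPExtends {I | I ∈ S} [] Δ w) : IsCPProof S Δ.reverse := by
  induction h with
  | refl => exact fun k => k.elim0
  | hyp _ hI ih =>
    rw [List.reverse_cons]
    exact isCPProof_append_singleton ih (.inl hI)
  | comb _ hI hJ hK ih =>
    rw [List.reverse_cons]
    exact isCPProof_append_singleton ih
      (.inr (.inl ⟨_, List.mem_reverse.2 hI, _, List.mem_reverse.2 hJ, hK⟩))
  | div _ hI hK ih =>
    rw [List.reverse_cons]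
    exact isCPProof_append_singleton ih (.inr (.inr ⟨_, List.mem_reverse.2 hI, hK⟩))

/-- `S` has a refutation of cost at most `r`. -/
def RefutableWithin {n : ℕ} (S : Set (LinIneq n)) (r : ℝ) : Prop :=
  ∃ π w, CPExtends S [] π w ∧ LinIneq.falsum n ∈ π ∧ (w : ℝ) ≤ r

theorem RefutableWithin.mono {n : ℕ} {S : Set (LinIneq n)} {r r' : ℝ}
    (h : RefutableWithin S r) (hr : r ≤ r') : RefutableWithin S r' := by
  obtain ⟨π, w, hπ, hf, hw⟩ := h
  exact ⟨π, w, hπ, hf, hw.trans hr⟩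

/-- The unit held back pays for copying `0 ≥ 1` to the end of the proof. -/
theorem RefutableWithin.exists_isCPRefutation {n : ℕ} {S : List (LinIneq n)} {r : ℝ}
    (h : RefutableWithin {I | I ∈ S} (r - 1)) :
    ∃ π, IsCPRefutation S π ∧ (π.length : ℝ) ≤ r := by
  obtain ⟨π, w, hπ, hf, hw⟩ := h
  have h1 : CPExtends {I | I ∈ S} [] (LinIneq.falsum n :: π) (w + 1) :=
    hπ.comb hf hf ⟨1, 0, by simp, by simp⟩
  refine ⟨_, ⟨h1.isCPProof_reverse, by simp⟩, ?_⟩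
  have h2 : ((LinIneq.falsum n :: π).reverse.length : ℝ) ≤ ((w + 1 : ℕ) : ℝ) := by
    rw [List.length_reverse]
    exact_mod_cast h1.length_le
  push_cast at h2
  linarith

/-! ### Weighted sums of axioms -/

/-- The sum of a list of inequalities with multiplicities. -/
def LinIneq.weightedSum {n : ℕ} (L : List (LinIneq n × ℕ)) : LinIneq n where
  coeff i := (L.map fun t => (t.2 : ℤ) * t.1.coeff i).sum
  rhs := (L.map fun t => (t.2 : ℤ) * t.1.rhs).sum

theorem CPExtends.exists_weightedSum {n : ℕ} {S : Set (LinIneq n)} {Γ : List (LinIneq n)}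
    {I₀ : LinIneq n} (h₀ : I₀ ∈ S) (L : List (LinIneq n × ℕ)) (hL : ∀ t ∈ L, t.1 ∈ S) :
    ∃ Δ, CPExtends S Γ Δ (2 * L.length + 2) ∧ LinIneq.weightedSum L ∈ Δ := by
  induction L with
  | nil =>
    refine ⟨_, (CPExtends.refl.hyp h₀).comb (K := LinIneq.weightedSum []) List.mem_cons_self
      List.mem_cons_self ⟨0, 0, ?_, ?_⟩, List.mem_cons_self⟩ <;> simp [LinIneq.weightedSum]
  | cons t L ih =>
    obtain ⟨Δ, hΔ, hmem⟩ := ih fun t ht => hL t (List.mem_cons_of_mem _ ht)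
    have h1 := (hΔ.hyp (hL t List.mem_cons_self)).comb (K := LinIneq.weightedSum (t :: L))
      List.mem_cons_self (List.mem_cons_of_mem _ hmem)
      ⟨t.2, 1, by simp [LinIneq.weightedSum], by simp [LinIneq.weightedSum]⟩
    exact ⟨_, h1, List.mem_cons_self⟩

/-! ### Lifting a refutation of a face -/

/-- The inequality `I` minus `m` times `a x ≥ M`. -/
def LinIneq.subMul {n : ℕ} (I : LinIneq n) (m : ℕ) (a : Fin n → ℤ) (M : ℤ) : LinIneq n where
  coeff i := I.coeff i - m * a i
  rhs := I.rhs - m * M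

/-- A derivation on the face `a x = M` lifts to one that only uses `a x ≤ M`: each line becomes
valid after subtracting a multiple of `a x ≥ M`. -/
theorem CPExtends.lift {n : ℕ} {S : Set (LinIneq n)} {Γ π : List (LinIneq n)} {w : ℕ}
    {a : Fin n → ℤ} {b M : ℤ} (h : CPExtends (insert ⟨a, b⟩ S) [] π w) (hbM : b ≤ M)
    (hM : (⟨-a, -M⟩ : LinIneq n) ∈ Γ) (hneg : (⟨0, -1⟩ : LinIneq n) ∈ Γ) :
    ∃ Δ w', CPExtends S Γ Δ w' ∧ 2 * w' ≤ 3 * w ∧ ∀ I ∈ π, ∃ m : ℕ, I.subMul m a M ∈ Δ := by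
  induction h with
  | refl => exact ⟨Γ, 0, .refl, le_rfl, by simp⟩
  | @hyp _ _ I _ hI ih =>
    obtain ⟨Δ, w', hΔ, hw, hall⟩ := ih
    rcases hI with rfl | hI
    -- On the face the added axiom is `0 ≥ b - M`, a multiple of `0 ≥ -1`.
    · refine ⟨_, _, hΔ.comb (K := LinIneq.subMul ⟨a, b⟩ 1 a M) (hΔ.subset hneg) (hΔ.subset hneg)
        ⟨(M - b).toNat, 0, ?_, ?_⟩, by omega, ?_⟩
      · simp [LinIneq.subMul]
      · simp [LinIneq.subMul, Int.toNat_of_nonneg (sub_nonneg.2 hbM)]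
      · intro I hI
        rcases List.mem_cons.1 hI with rfl | hI
        · exact ⟨1, List.mem_cons_self⟩
        · obtain ⟨m, hm⟩ := hall I hI
          exact ⟨m, List.mem_cons_of_mem _ hm⟩
    · refine ⟨_, _, hΔ.hyp hI, by omega, ?_⟩
      intro I' hI'
      rcases List.mem_cons.1 hI' with rfl | hI'
      · refine ⟨0, ?_⟩
        have : I'.subMul 0 a M = I' := by ext <;> simp [LinIneq.subMul]
        rw [this]; exact List.mem_cons_self
      · obtain ⟨m, hm⟩ := hall I' hI'
        exact ⟨m, List.mem_cons_of_mem _ hm⟩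
  | @comb _ _ I J K _ hI hJ hK ih =>
    obtain ⟨Δ, w', hΔ, hw, hall⟩ := ih
    obtain ⟨m, hm⟩ := hall I hI
    obtain ⟨k, hk⟩ := hall J hJ
    obtain ⟨p, q, hc, hr⟩ := hK
    refine ⟨_, _, hΔ.comb (K := K.subMul (p * m + q * k) a M) hm hk ⟨p, q, ?_, ?_⟩, by omega, ?_⟩
    · intro i
      simp only [LinIneq.subMul, hc]; push_cast; ring
    · simp only [LinIneq.subMul, hr]; push_cast; ring
    · intro I' hI'
      rcases List.mem_cons.1 hI' with rfl | hI'
      · exact ⟨_, List.mem_cons_self⟩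
      · obtain ⟨m, hm⟩ := hall I' hI'
        exact ⟨m, List.mem_cons_of_mem _ hm⟩
  | @div _ _ I K _ hI hK ih =>
    obtain ⟨Δ, w', hΔ, hw, hall⟩ := ih
    obtain ⟨m, hm⟩ := hall I hI
    obtain ⟨d, hd, hc, hr⟩ := hK
    have hdm : m ≤ d * m := Nat.le_mul_of_pos_left m hd
    -- Division needs a correction divisible by `d`, so `m` is first raised to `d * m` by adding
    -- copies of `a x ≤ M`. A division of cost `2` thus becomes cost `1 + 2`, the source of the
    -- factor `3 / 2`.
    have h1 := hΔ.comb (K := I.subMul (d * m) a M) hm (hΔ.subset hM) ⟨1, d * m - m, by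
        intro i
        simp only [LinIneq.subMul, Pi.neg_apply]; push_cast [hdm]; ring, by
        simp only [LinIneq.subMul]; push_cast [hdm]; ring⟩
    have h2 := h1.div (K := K.subMul m a M) List.mem_cons_self ⟨d, hd, by
        intro i
        simp only [LinIneq.subMul, hc]; push_cast; ring, by
        have hd' : (d : ℚ) ≠ 0 := by exact_mod_cast hd.ne'
        simp only [LinIneq.subMul, hr]
        rw [← Int.ceil_sub_intCast]
        congr 1
        push_cast
        field_simp⟩
    refine ⟨_, _, h2, by omega, ?_⟩
    intro I' hI'
    rcases List.mem_cons.1 hI' with rfl | hI'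
    · exact ⟨m, List.mem_cons_self⟩
    · obtain ⟨m, hm⟩ := hall I' hI'
      exact ⟨m, List.mem_cons_of_mem _ (List.mem_cons_of_mem _ hm)⟩

/-- If `S` with `a x ≥ b` is refutable, then `a x ≤ M` can be tightened to `a x ≤ M - 1` for every
`M ≥ b`. -/
theorem CPExtends.tighten {n : ℕ} {S : Set (LinIneq n)} {Γ π : List (LinIneq n)} {w : ℕ}
    {a : Fin n → ℤ} {b M : ℤ} (h : CPExtends (insert ⟨a, b⟩ S) [] π w)
    (hf : LinIneq.falsum n ∈ π) (hbM : b ≤ M)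
    (hM : (⟨-a, -M⟩ : LinIneq n) ∈ Γ) (hneg : (⟨0, -1⟩ : LinIneq n) ∈ Γ) :
    ∃ Δ w', CPExtends S Γ Δ w' ∧ 2 * w' ≤ 3 * w + 6 ∧ (⟨-a, -(M - 1)⟩ : LinIneq n) ∈ Δ := by
  obtain ⟨Δ, w', hΔ, hw, hall⟩ := h.lift hbM hM hneg
  obtain ⟨m, hm⟩ := hall _ hf
  have h1 := hΔ.comb (K := (LinIneq.falsum n).subMul (m + 1) a M) hm (hΔ.subset hM) ⟨1, 1, by
      intro i
      simp only [LinIneq.subMul, Pi.neg_apply]; push_cast; ring, by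
      simp only [LinIneq.subMul]; push_cast; ring⟩
  -- Using `m + 1` rather than `m` keeps the divisor positive when `m = 0`. The gain is `⌈1 / (m +
  -- 1)⌉ = 1`.
  have h2 := h1.div (K := ⟨-a, -(M - 1)⟩) List.mem_cons_self ⟨m + 1, Nat.succ_pos _, by
      intro i
      simp [LinIneq.subMul, LinIneq.falsum], by
      simp only [LinIneq.subMul, LinIneq.falsum]
      have hm0 : (0 : ℚ) < (m : ℚ) + 1 := by positivity
      symm
      rw [Int.ceil_eq_iff]
      push_cast
      constructor
      · rw [lt_div_iff₀ hm0]; linarith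
      · rw [div_le_iff₀ hm0]
        have : (0 : ℚ) ≤ m := by positivity
        linarith⟩
  exact ⟨_, _, h2, by omega, List.mem_cons_self⟩

/-- Repeated tightening, from `a x ≤ b - 1 + R` down to `a x ≤ b - 1`. -/
theorem CPExtends.tighten_iterate {n : ℕ} {S : Set (LinIneq n)} {π : List (LinIneq n)} {w : ℕ}
    {a : Fin n → ℤ} {b : ℤ} (h : CPExtends (insert ⟨a, b⟩ S) [] π w)
    (hf : LinIneq.falsum n ∈ π) (R : ℕ) : ∀ {Γ : List (LinIneq n)},
    (⟨-a, -(b - 1 + R)⟩ : LinIneq n) ∈ Γ → (⟨0, -1⟩ : LinIneq n) ∈ Γ →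
    ∃ Δ w', CPExtends S Γ Δ w' ∧ 2 * w' ≤ R * (3 * w + 6) ∧ (⟨-a, 1 - b⟩ : LinIneq n) ∈ Δ := by
  induction R with
  | zero =>
    intro Γ hM _
    refine ⟨Γ, 0, .refl, by simp, ?_⟩
    convert hM using 2
    push_cast; ring
  | succ R ih =>
    intro Γ hM hneg
    obtain ⟨Δ, v, hΔ, hv, hmem⟩ := h.tighten hf (by push_cast; linarith) hM hneg
    obtain ⟨Θ, u, hΘ, hu, hmem'⟩ := ih (Γ := Δ) (by
      convert hmem using 3
      push_cast; ring) (hΔ.subset hneg)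
    exact ⟨Θ, v + u, hΔ.trans hΘ, by linarith [Nat.succ_mul R (3 * w + 6)], hmem'⟩

/-! ### Branching on a query -/

/-- The system contains `x i ≥ 0` and `-x i ≥ -1` for every variable. -/
def ContainsCube {n : ℕ} (S : Set (LinIneq n)) : Prop :=
  ∀ i : Fin n, (⟨Pi.single i 1, 0⟩ : LinIneq n) ∈ S ∧ (⟨Pi.single i (-1), -1⟩ : LinIneq n) ∈ S

theorem ContainsCube.exists_upper {n : ℕ} {S : Set (LinIneq n)} {Γ : List (LinIneq n)}
    (hS : ContainsCube S) (hn : 1 ≤ n) (a : Fin n → ℤ) :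
    ∃ Δ, CPExtends S Γ Δ (2 * n + 2) ∧ (⟨-a, -∑ i, max (a i) 0⟩ : LinIneq n) ∈ Δ := by
  -- The sign of `a i` decides which bound on `x i` contributes the term `-a i * x i`.
  let f : Fin n → LinIneq n × ℕ := fun i =>
    if 0 ≤ a i then (⟨Pi.single i (-1), -1⟩, (a i).toNat) else (⟨Pi.single i 1, 0⟩, (-a i).toNat)
  obtain ⟨Δ, hΔ, hmem⟩ := CPExtends.exists_weightedSum (Γ := Γ) (hS ⟨0, hn⟩).1
    ((List.finRange n).map f) (by
      simp only [List.mem_map, List.mem_finRange, true_and, forall_exists_index,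
        forall_apply_eq_imp_iff, f]
      intro i
      split_ifs
      exacts [(hS i).2, (hS i).1])
  refine ⟨Δ, by simpa using hΔ, ?_⟩
  convert hmem using 1
  have hc : ∀ i j, ((f i).2 : ℤ) * (f i).1.coeff j = if j = i then -a i else 0 := by
    intro i j
    by_cases h : 0 ≤ a i
    · have : (((a i).toNat : ℕ) : ℤ) = a i := Int.toNat_of_nonneg h
      simp only [f, if_pos h, this, Pi.single_apply]
      split_ifs <;> ring
    · have : (((-a i).toNat : ℕ) : ℤ) = -a i := Int.toNat_of_nonneg (by linarith)
      simp only [f, if_neg h, this, Pi.single_apply]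
      split_ifs <;> ring
  have hr : ∀ i, ((f i).2 : ℤ) * (f i).1.rhs = -max (a i) 0 := by
    intro i
    by_cases h : 0 ≤ a i
    · have : (((a i).toNat : ℕ) : ℤ) = a i := Int.toNat_of_nonneg h
      simp only [f, if_pos h, this, max_eq_left h]
      ring
    · simp [f, if_neg h, max_eq_right (not_le.1 h).le]
  ext j
  · simp only [LinIneq.weightedSum, List.map_map, Function.comp_def, hc, ← Fin.sum_univ_def]
    simp
  · simp only [LinIneq.weightedSum, List.map_map, Function.comp_def, hr, ← Fin.sum_univ_def]
    simp

theorem ContainsCube.exists_neg_one {n : ℕ} {S : Set (LinIneq n)} {Γ : List (LinIneq n)}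
    (hS : ContainsCube S) (hn : 1 ≤ n) :
    ∃ Δ, CPExtends S Γ Δ 3 ∧ (⟨0, -1⟩ : LinIneq n) ∈ Δ := by
  refine ⟨_, ((CPExtends.refl.hyp (hS ⟨0, hn⟩).1).hyp (hS ⟨0, hn⟩).2).comb (K := ⟨0, -1⟩)
    List.mem_cons_self (List.mem_cons_of_mem _ List.mem_cons_self) ⟨1, 1, ?_, by simp⟩,
    List.mem_cons_self⟩
  intro i
  by_cases h : i = ⟨0, hn⟩ <;> simp [h]

/-- An inequality that follows from the bounds on the variables is redundant. -/
theorem RefutableWithin.of_le {n : ℕ} {S : Set (LinIneq n)} {r : ℝ} (hS : ContainsCube S)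
    (hn : 1 ≤ n) {a : Fin n → ℤ} {b : ℤ} (hb : ∑ i, max (a i) 0 ≤ b)
    (h : RefutableWithin (insert ⟨-a, -b⟩ S) r) : RefutableWithin S (r + (2 * n + 6)) := by
  obtain ⟨π, w, hπ, hf, hw⟩ := h
  obtain ⟨Γ, hΓ, hneg⟩ := hS.exists_neg_one (Γ := []) hn
  obtain ⟨Δ, hΔ, hup⟩ := hS.exists_upper (Γ := Γ) hn a
  have h1 := (hΓ.trans hΔ).comb (K := ⟨-a, -b⟩) hup (hΔ.subset hneg)
    ⟨1, (b - ∑ i, max (a i) 0).toNat, by simp, by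
      simp only [Int.toNat_of_nonneg (sub_nonneg.2 hb)]
      push_cast; ring⟩
  obtain ⟨Θ, hΘ, hsub⟩ := hπ.cut (Γ := ⟨-a, -b⟩ :: Δ) List.mem_cons_self
  refine ⟨Θ, _, h1.trans hΘ, hsub hf, ?_⟩
  push_cast
  linarith

/-- A refutation of each side of a query yields a refutation, in which the refutation of the
first side is repeated at most `c * n` times. -/
theorem RefutableWithin.branch {n c : ℕ} {S : Set (LinIneq n)} {r₁ r₂ : ℝ} (hS : ContainsCube S)
    (hn : 1 ≤ n) (hc : 1 ≤ c) {a : Fin n → ℤ} {b : ℤ} (ha : ∀ i, |a i| ≤ (c : ℤ))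
    (h₁ : RefutableWithin (insert ⟨a, b⟩ S) r₁)
    (h₂ : RefutableWithin (insert ⟨-a, 1 - b⟩ S) r₂) :
    RefutableWithin S (c * n * (3 / 2 * r₁ + 3) + r₂ + (2 * n + 6)) := by
  have hr₁ : 0 ≤ r₁ := by
    obtain ⟨_, w, _, _, hw⟩ := h₁
    exact (Nat.cast_nonneg w).trans hw
  have hr₂ : 0 ≤ r₂ := by
    obtain ⟨_, w, _, _, hw⟩ := h₂
    exact (Nat.cast_nonneg w).trans hw
  have hcn : (1 : ℝ) ≤ c * n := by
    exact_mod_cast Nat.one_le_iff_ne_zero.2 (Nat.mul_ne_zero (by omega) (by omega))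
  -- If one side of the query holds on the whole cube, its refutation alone suffices. Otherwise `b -
  -- 1` is at least the minimum of `a x` on the cube, so the distance `R` from the maximum down to
  -- `b - 1` is at most `∑ |a i| ≤ c * n`.
  by_cases hlo : ∑ i, max ((-a) i) 0 ≤ -b
  · refine (RefutableWithin.of_le (r := r₁) hS hn hlo (by simpa using h₁)).mono ?_
    nlinarith
  by_cases hhi : ∑ i, max (a i) 0 ≤ b - 1
  · refine (RefutableWithin.of_le (r := r₂) hS hn hhi (by simpa using h₂)).mono ?_
    have : 0 ≤ (c : ℝ) * n * (3 / 2 * r₁ + 3) := by positivity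
    linarith
  have hsum : ∑ i, max (a i) 0 + ∑ i, max ((-a) i) 0 ≤ c * n := by
    rw [← Finset.sum_add_distrib]
    calc ∑ i, (max (a i) 0 + max ((-a) i) 0) ≤ ∑ _i : Fin n, (c : ℤ) := by
          refine Finset.sum_le_sum fun i _ => ?_
          have := ha i
          simp only [Pi.neg_apply]
          grind
      _ = c * n := by simp [mul_comm]
  obtain ⟨R, hR⟩ := Int.eq_ofNat_of_zero_le (a := ∑ i, max (a i) 0 - (b - 1)) (by linarith)
  have hRc : (R : ℝ) ≤ c * n := by
    have : (R : ℤ) ≤ c * n := by omega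
    exact_mod_cast this
  obtain ⟨π₁, w₁, hπ₁, hf₁, hw₁⟩ := h₁
  obtain ⟨π₂, w₂, hπ₂, hf₂, hw₂⟩ := h₂
  obtain ⟨Γ, hΓ, hneg⟩ := hS.exists_neg_one (Γ := []) hn
  obtain ⟨Δ, hΔ, hup⟩ := hS.exists_upper (Γ := Γ) hn a
  obtain ⟨Θ, u, hΘ, hu, hmem⟩ := hπ₁.tighten_iterate hf₁ R (Γ := Δ)
    (by rwa [show b - 1 + (R : ℤ) = ∑ i, max (a i) 0 by
      have : (R : ℤ) = Int.ofNat R := rfl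
      linarith]) (hΔ.subset hneg)
  obtain ⟨Ξ, hΞ, hsub⟩ := hπ₂.cut hmem
  refine ⟨Ξ, _, ((hΓ.trans hΔ).trans hΘ).trans hΞ, hsub hf₂, ?_⟩
  have hu' : (2 : ℝ) * u ≤ R * (3 * w₁ + 6) := by exact_mod_cast hu
  have h3 : (R : ℝ) * (3 * w₁ + 6) ≤ c * n * (3 * r₁ + 6) := by gcongr
  push_cast
  linarith

/-! ### Leaves -/

theorem exists_common_multiplier (comb : List (ℕ × ℚ≥0)) :
    ∃ N : ℕ, 0 < N ∧ ∀ t ∈ comb, ∃ k : ℕ, (N : ℚ) * (t.2 : ℚ) = k := by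
  induction comb with
  | nil => exact ⟨1, one_pos, by simp⟩
  | cons t L ih =>
    obtain ⟨N, hN, h⟩ := ih
    refine ⟨t.2.den * N, Nat.mul_pos t.2.den_pos hN, ?_⟩
    intro u hu
    rcases List.mem_cons.1 hu with rfl | hu
    · refine ⟨N * u.2.num, ?_⟩
      have h1 : (u.2.den : ℚ) * (u.2 : ℚ) = u.2.num := by
        exact_mod_cast congrArg (NNRat.cast : ℚ≥0 → ℚ) (NNRat.den_mul_eq_num u.2)
      push_cast
      rw [← h1]; ring
    · obtain ⟨k, hk⟩ := h u hu
      refine ⟨t.2.den * k, ?_⟩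
      push_cast
      rw [← hk]; ring

/-- Clearing denominators by a common `N` gives `0 ≥ N`, and division by `N` gives `0 ≥ 1`. -/
theorem CombYieldsFalsum.refutableWithin {n : ℕ} {S : List (LinIneq n)} {comb : List (ℕ × ℚ≥0)}
    (h : CombYieldsFalsum S comb) {I₀ : LinIneq n} (h₀ : I₀ ∈ S) :
    RefutableWithin {I | I ∈ S} (2 * comb.length + 4) := by
  obtain ⟨hlt, hc, hr⟩ := h
  obtain ⟨N, hN, hk⟩ := exists_common_multiplier comb
  let k : ℕ × ℚ≥0 → ℕ := fun t => ⌊(N : ℚ) * (t.2 : ℚ)⌋₊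
  have hk' : ∀ t ∈ comb, (k t : ℚ) = N * t.2 := by
    intro t ht
    obtain ⟨m, hm⟩ := hk t ht
    simp [k, hm]
  have hsum : ∀ g : LinIneq n → ℤ, ((comb.map fun t => (k t : ℤ) * g (S.getD t.1 ⟨0, 0⟩)).sum : ℚ)
      = N * (comb.map fun t => (t.2 : ℚ) * (g (S.getD t.1 ⟨0, 0⟩) : ℚ)).sum := by
    intro g
    rw [← List.sum_map_mul_left, Int.cast_list_sum, List.map_map]
    refine congrArg List.sum (List.map_congr_left fun t ht => ?_)
    simp only [Function.comp_apply]
    push_cast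
    rw [hk' t ht, mul_assoc]
  obtain ⟨Δ, hΔ, hmem⟩ := CPExtends.exists_weightedSum (S := {I | I ∈ S}) (Γ := []) h₀
    (comb.map fun t => (S.getD t.1 ⟨0, 0⟩, k t)) (by
      intro u hu
      obtain ⟨t, ht, rfl⟩ := List.mem_map.1 hu
      change S.getD t.1 ⟨0, 0⟩ ∈ S
      rw [List.getD_eq_getElem _ _ (hlt t ht)]
      exact List.getElem_mem _)
  have h1 := hΔ.div (K := LinIneq.falsum n) hmem ⟨N, hN, by
      intro i
      have := hsum (fun I => I.coeff i)
      rw [hc i, mul_zero] at this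
      simpa [LinIneq.weightedSum, LinIneq.falsum, Function.comp_def] using mod_cast this, by
      have := hsum LinIneq.rhs
      rw [hr, mul_one] at this
      have h2 : (LinIneq.weightedSum (comb.map fun t => (S.getD t.1 ⟨0, 0⟩, k t))).rhs = (N : ℤ) := by
        simp only [LinIneq.weightedSum, List.map_map, Function.comp_def]
        exact_mod_cast this
      rw [h2]
      have hN' : (N : ℚ) ≠ 0 := by exact_mod_cast hN.ne'
      simp [LinIneq.falsum, div_self hN']⟩
  refine ⟨_, _, h1, List.mem_cons_self, ?_⟩
  simp only [List.length_map]
  push_cast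
  linarith

/-- By Carathéodory's theorem, `n + 2` inequalities suffice to obtain `0 ≥ 1`. -/
theorem CombYieldsFalsum.exists_length_le {n : ℕ} {S : List (LinIneq n)} {comb : List (ℕ × ℚ≥0)}
    (h : CombYieldsFalsum S comb) :
    ∃ comb', CombYieldsFalsum S comb' ∧ comb'.length ≤ n + 2 := by
  obtain ⟨hlt, hc, hr⟩ := h
  -- An inequality is a vector in dimension `n + 1`. Dividing by the total weight `W` makes the
  -- conic combination convex; an affinely independent subfamily has at most `n + 2` members.
  let v : ℕ → (Fin n → ℚ) × ℚ := fun k =>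
    (fun i => ((S.getD k ⟨0, 0⟩).coeff i : ℚ), ((S.getD k ⟨0, 0⟩).rhs : ℚ))
  let s : Set ((Fin n → ℚ) × ℚ) := v '' {k | k < S.length}
  let W : ℚ := ∑ j : Fin comb.length, (comb.get j).2
  have hsumget : ∀ g : ℕ × ℚ≥0 → ℚ, ∑ j : Fin comb.length, g (comb.get j) = (comb.map g).sum := by
    intro g
    rw [Fin.sum_univ_def, ← Function.comp_def g comb.get, ← List.map_map,
      List.map_get_finRange]
  have hvec : ∑ j : Fin comb.length, ((comb.get j).2 : ℚ) • v (comb.get j).1 = (0, 1) := by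
    ext i
    · rw [Prod.fst_sum, Finset.sum_apply]
      simp only [v, Prod.smul_fst, Pi.smul_apply, smul_eq_mul]
      rw [hsumget fun t => (t.2 : ℚ) * ((S.getD t.1 ⟨0, 0⟩).coeff i : ℚ), hc i]
      rfl
    · rw [Prod.snd_sum]
      simp only [v, Prod.smul_snd, smul_eq_mul]
      rw [hsumget fun t => (t.2 : ℚ) * ((S.getD t.1 ⟨0, 0⟩).rhs : ℚ), hr]
  have hnn : ∀ j : Fin comb.length, 0 ≤ ((comb.get j).2 : ℚ) := fun j => NNRat.cast_nonneg _
  have hW : 0 < W := by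
    refine lt_of_le_of_ne (Finset.sum_nonneg fun j _ => hnn j) fun h0 => ?_
    have h1 : ∀ j, ((comb.get j).2 : ℚ) = 0 := fun j =>
      (Finset.sum_eq_zero_iff_of_nonneg fun j _ => hnn j).1 h0.symm j (Finset.mem_univ j)
    simp only [h1, zero_smul, Finset.sum_const_zero] at hvec
    exact zero_ne_one (congrArg Prod.snd hvec)
  have hmem : W⁻¹ • ((0, 1) : (Fin n → ℚ) × ℚ) ∈ convexHull ℚ s := by
    have h1 := Finset.centerMass_mem_convexHull (R := ℚ) (s := s) Finset.univ
      (w := fun j : Fin comb.length => ((comb.get j).2 : ℚ))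
      (z := fun j => v (comb.get j).1) (fun j _ => hnn j) hW
      (fun j _ => ⟨_, hlt _ (List.get_mem _ _), rfl⟩)
    rwa [Finset.centerMass, hvec] at h1
  obtain ⟨ι, _, z, w, hz, hind, hw, -, hx⟩ := eq_pos_convex_span_of_mem_convexHull hmem
  choose p hp hpz using fun i => hz (Set.mem_range_self i)
  have hcard : Fintype.card ι ≤ n + 2 := by
    have := hind.card_le_finrank_succ
    have h2 : Module.finrank ℚ (vectorSpan ℚ (Set.range z)) ≤ n + 1 := by
      refine (Submodule.finrank_le _).trans ?_
      simp
    omega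
  have hval : ∀ i, (((w i * W).toNNRat : ℚ≥0) : ℚ) = w i * W := fun i =>
    Rat.coe_toNNRat _ (mul_pos (hw i) hW).le
  have htot : ∑ i, (w i * W) • v (p i) = (0, 1) := by
    have h1 : ∑ i, (w i * W) • v (p i) = W • ∑ i, w i • z i := by
      rw [Finset.smul_sum]
      refine Finset.sum_congr rfl fun i _ => ?_
      rw [hpz i, smul_smul, mul_comm]
    rw [h1, hx, smul_inv_smul₀ hW.ne']
  refine ⟨(Finset.univ : Finset ι).toList.map fun i => (p i, (w i * W).toNNRat), ⟨?_, ?_, ?_⟩, ?_⟩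
  · intro t ht
    obtain ⟨i, _, rfl⟩ := List.mem_map.1 ht
    exact hp i
  · intro j
    have h1 := congrFun (congrArg Prod.fst htot) j
    rw [Prod.fst_sum, Finset.sum_apply] at h1
    simp only [List.map_map, Function.comp_def, hval, Finset.sum_map_toList]
    simpa [v] using h1
  · have h1 := congrArg Prod.snd htot
    rw [Prod.snd_sum] at h1
    simp only [List.map_map, Function.comp_def, hval, Finset.sum_map_toList]
    simpa [v] using h1
  · simpa using hcard

/-! ### Trees -/

/-- A leaf yielding `0 ≥ 1` has a nonzero multiplier: one bit each for node, numerator and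
denominator. Position `0` has length zero. -/
theorem SPTree.three_le_size {n : ℕ} (T : SPTree n) {S : List (LinIneq n)} (h : T.Refutes S) :
    3 ≤ T.size := by
  induction T generalizing S with
  | leaf comb =>
    simp only [SPTree.Refutes] at h
    obtain ⟨t, ht, htne⟩ : ∃ t ∈ comb, t.2 ≠ 0 := by
      by_contra! hall
      have h1 := h.2.2
      rw [List.sum_eq_zero (by
        intro x hx
        obtain ⟨t, ht, rfl⟩ := List.mem_map.1 hx
        simp [hall t ht])] at h1
      exact zero_ne_one h1
    have h1 := List.single_le_sum (l := comb.map fun t => Nat.size t.1 + Nat.size t.2.num +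
      Nat.size t.2.den) (by simp) _ (List.mem_map_of_mem ht)
    have h2 : 0 < Nat.size t.2.num := Nat.size_pos.2 (NNRat.num_pos.2 (pos_iff_ne_zero.2 htne))
    have h3 : 0 < Nat.size t.2.den := Nat.size_pos.2 t.2.den_pos
    simp only [SPTree.size]
    omega
  | query a b l r ihl ihr =>
    have := ihl h.1
    simp only [SPTree.size]
    omega

theorem SPTree.size_query_ge {n : ℕ} (a : Fin n → ℤ) (b : ℤ) (l r : SPTree n) :
    l.size + r.size + (n + 2) ≤ (SPTree.query a b l r).size := by
  have h1 : n ≤ ∑ i, intSize (a i) := by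
    calc n = ∑ _i : Fin n, 1 := by simp
      _ ≤ _ := Finset.sum_le_sum fun i _ => by simp [intSize]
  have h2 : 1 ≤ intSize b := by simp [intSize]
  simp only [SPTree.size]
  omega

theorem length_add_one_le_size_leaf {n : ℕ} (comb : List (ℕ × ℚ≥0)) :
    comb.length + 1 ≤ (SPTree.leaf comb : SPTree n).size := by
  have h1 : ∀ x ∈ comb.map fun t => Nat.size t.1 + Nat.size t.2.num + Nat.size t.2.den,
      1 ≤ x := by
    intro x hx
    obtain ⟨t, _, rfl⟩ := List.mem_map.1 hx
    have h3 : 0 < Nat.size t.2.den := Nat.size_pos.2 t.2.den_pos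
    omega
  have h2 := List.length_le_sum_of_one_le _ h1
  rw [List.length_map] at h2
  simp only [SPTree.size]
  omega

/-- A potential `φ` that pays for every leaf and every query bounds the cost of a refutation. -/
theorem SPTree.refutableWithin {n c : ℕ} (hn : 1 ≤ n) (hc : 1 ≤ c) (φ : SPTree n → ℝ)
    (hleaf : ∀ (S : List (LinIneq n)) comb, ContainsCube {I | I ∈ S} → CombYieldsFalsum S comb →
      RefutableWithin {I | I ∈ S} (φ (leaf comb)))
    (hquery : ∀ a b l r, 3 ≤ l.size → 3 ≤ r.size →
      (c * n * (3 / 2 * φ l + 3) + φ r + (2 * n + 6) ≤ φ (query a b l r) ∨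
        c * n * (3 / 2 * φ r + 3) + φ l + (2 * n + 6) ≤ φ (query a b l r)))
    (T : SPTree n) (S : List (LinIneq n)) (hS : ContainsCube {I | I ∈ S}) (hT : T.Refutes S)
    (hTc : T.CoeffBound c) : RefutableWithin {I | I ∈ S} (φ T) := by
  induction T generalizing S with
  | leaf comb => exact hleaf S comb hS hT
  | query a b l r ihl ihr =>
    obtain ⟨hl, hr⟩ := hT
    obtain ⟨ha, hlc, hrc⟩ := hTc
    have hins : ∀ J, {I | I ∈ S ++ [J]} = insert J {I | I ∈ S} := by
      intro J
      ext I
      simp [or_comm]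
    have hcube : ∀ J, ContainsCube {I | I ∈ S ++ [J]} := fun J i =>
      ⟨List.mem_append_left _ (hS i).1, List.mem_append_left _ (hS i).2⟩
    have h1 := ihl _ (hcube _) hl hlc
    have h2 := ihr _ (hcube _) hr hrc
    rw [hins] at h1 h2
    rcases hquery a b l r (l.three_le_size hl) (r.three_le_size hr) with h | h
    -- Repeating the left side is the same argument for the query read as `(-a) x ≥ 1 - b`.
    · refine (RefutableWithin.branch (a := -a) (b := 1 - b) hS hn hc (by simpa using ha) h1 ?_).mono h
      simpa using h2
    · exact (RefutableWithin.branch hS hn hc ha h2 h1).mono h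

theorem CNFFormula.containsCube_system {n : ℕ} (F : CNFFormula n) :
    ContainsCube {I | I ∈ F.system} := by
  intro i
  simp [CNFFormula.system]

/-! ### Numerical estimates -/

theorem mul_rpow_logb_two {m s : ℝ} (hm : 0 < m) (hs : 0 < s) :
    s * m ^ Real.logb 2 s = s ^ (1 + Real.logb 2 m) := by
  rw [Real.rpow_add hs, Real.rpow_one, Real.rpow_def_of_pos hm, Real.rpow_def_of_pos hs,
    Real.logb, Real.logb]
  congr 2
  ring

/-- The points `2 x` and `y` lie in `[x, x + y]` and have the same sum as its endpoints, so
convexity gives `(2 x) ^ p + y ^ p ≤ x ^ p + (x + y) ^ p`. Here `(2 x) ^ p = 2 m x ^ p`, and `3 / 2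
* m ≤ 2 m - 1` exactly when `m ≥ 2`. -/
theorem rpow_branch_le {m x y : ℝ} (hm : 2 ≤ m) (hx : 0 < x) (hxy : x ≤ y) :
    3 / 2 * m * x ^ (1 + Real.logb 2 m) + y ^ (1 + Real.logb 2 m) ≤
      (x + y) ^ (1 + Real.logb 2 m) := by
  set p := 1 + Real.logb 2 m with hp
  have hlog : 0 ≤ Real.logb 2 m := Real.logb_nonneg (by norm_num) (by linarith)
  have hconv := convexOn_rpow (p := p) (by linarith)
  have hy : 0 < y := hx.trans_le hxy
  have hθ : 0 ≤ (y - x) / y := div_nonneg (by linarith) hy.le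
  have hθ' : 0 ≤ x / y := by positivity
  have hx' : x ∈ Set.Ici (0 : ℝ) := hx.le
  have hxy' : x + y ∈ Set.Ici (0 : ℝ) := (add_pos hx hy).le
  have hone : x / y + (y - x) / y = 1 := by field_simp; ring
  have h1 := hconv.2 hx' hxy' hθ' hθ hone
  have h2 := hconv.2 hx' hxy' hθ hθ' (by linarith)
  simp only [smul_eq_mul] at h1 h2
  rw [show x / y * x + (y - x) / y * (x + y) = y by field_simp; ring] at h1
  rw [show (y - x) / y * x + x / y * (x + y) = 2 * x by field_simp; ring] at h2
  have h3 : (2 * x) ^ p = 2 * m * x ^ p := by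
    rw [Real.mul_rpow (by norm_num) hx.le, hp, Real.rpow_add (by norm_num : (0 : ℝ) < 2),
      Real.rpow_one, Real.rpow_logb (by norm_num) (by norm_num) (by linarith)]
  have h4 : 0 < x ^ p := Real.rpow_pos_of_pos hx p
  have h5 : x / y * x ^ p + (y - x) / y * (x + y) ^ p +
      ((y - x) / y * x ^ p + x / y * (x + y) ^ p) = x ^ p + (x + y) ^ p := by
    linear_combination (x ^ p + (x + y) ^ p) * hone
  nlinarith

theorem rpow_add_ge {m t q : ℝ} (hm : 2 ≤ m) (ht : 0 < t) (hq : 0 ≤ q) (h8 : 8 ≤ t + q) :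
    t ^ (1 + Real.logb 2 m) + q * m ^ 3 ≤ (t + q) ^ (1 + Real.logb 2 m) := by
  have hlog : 0 ≤ Real.logb 2 m := Real.logb_nonneg (by norm_num) (by linarith)
  have htq : 0 < t + q := by linarith
  rw [Real.rpow_add htq, Real.rpow_add ht, Real.rpow_one, Real.rpow_one, add_mul]
  have h1 : t ^ Real.logb 2 m ≤ (t + q) ^ Real.logb 2 m :=
    Real.rpow_le_rpow ht.le (by linarith) hlog
  have h2 : m ^ 3 ≤ (t + q) ^ Real.logb 2 m := by
    refine le_trans (le_of_eq ?_) (Real.rpow_le_rpow (by norm_num) h8 hlog)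
    rw [show (8 : ℝ) = 2 ^ (3 : ℝ) by norm_num, ← Real.rpow_mul (by norm_num), mul_comm,
      Real.rpow_mul (by norm_num), Real.rpow_logb (by norm_num) (by norm_num) (by linarith)]
    norm_num
  gcongr

/-! ### The two bounds -/

theorem SPTree.refutableWithin_size {n c : ℕ} (hn : 1 ≤ n) (hc : 1 ≤ c) (hcn : 2 ≤ c * n)
    {T : SPTree n} {S : List (LinIneq n)} (hS : ContainsCube {I | I ∈ S}) (hT : T.Refutes S)
    (hTc : T.CoeffBound c) :
    RefutableWithin {I | I ∈ S} ((T.size : ℝ) ^ (1 + Real.logb 2 ((c : ℝ) * n)) - 1) := by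
  have hm : (2 : ℝ) ≤ (c : ℝ) * n := by exact_mod_cast hcn
  have hn' : (1 : ℝ) ≤ n := by exact_mod_cast hn
  have hlog : 1 ≤ Real.logb 2 ((c : ℝ) * n) := by
    rw [Real.le_logb_iff_rpow_le (by norm_num) (by linarith), Real.rpow_one]; exact hm
  have hstep : ∀ x y s : ℝ, 3 ≤ x → x ≤ y → x + y + (n + 2) ≤ s →
      c * n * (3 / 2 * (x ^ (1 + Real.logb 2 ((c : ℝ) * n)) - 1) + 3) +
        (y ^ (1 + Real.logb 2 ((c : ℝ) * n)) - 1) + (2 * n + 6) ≤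
      s ^ (1 + Real.logb 2 ((c : ℝ) * n)) - 1 := by
    intro x y s hx hxy hs
    have h1 := rpow_branch_le hm (by linarith : 0 < x) hxy
    -- The query's own `n + 2` bits add at least `(n + 2) * m ^ 3`, which covers all additive terms.
    have h2 := rpow_add_ge (q := n + 2) hm (by linarith : 0 < x + y) (by linarith) (by linarith)
    have h3 : (x + y + (n + 2)) ^ (1 + Real.logb 2 ((c : ℝ) * n)) ≤
        s ^ (1 + Real.logb 2 ((c : ℝ) * n)) :=
      Real.rpow_le_rpow (by linarith) hs (by linarith)
    have h4 : 4 * ((c : ℝ) * n) ≤ ((c : ℝ) * n) ^ 3 := by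
      have : 2 ^ 2 ≤ ((c : ℝ) * n) ^ 2 := by gcongr
      nlinarith
    have h5 : ((n : ℝ) + 2) * (4 * ((c : ℝ) * n)) ≤ (n + 2) * ((c : ℝ) * n) ^ 3 := by gcongr
    nlinarith
  refine SPTree.refutableWithin hn hc
    (fun T => (T.size : ℝ) ^ (1 + Real.logb 2 ((c : ℝ) * n)) - 1) ?_ ?_ T S hS hT hTc
  · intro S comb hS h
    refine (h.refutableWithin (hS ⟨0, hn⟩).1).mono ?_
    have h3 : (3 : ℝ) ≤ ((SPTree.leaf comb : SPTree n).size : ℝ) := by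
      exact_mod_cast SPTree.three_le_size (.leaf comb) h
    have h4 : (comb.length : ℝ) + 1 ≤ ((SPTree.leaf comb : SPTree n).size : ℝ) := by
      exact_mod_cast length_add_one_le_size_leaf (n := n) comb
    -- With `s` the leaf size, the need is `2 (s - 1) + 4 ≤ s ^ 2 - 1`, that is `(s - 3) (s + 1) ≥
    -- 0`; hence the minimum size `3`.
    have h5 : ((SPTree.leaf comb : SPTree n).size : ℝ) ^ (2 : ℝ) ≤
        ((SPTree.leaf comb : SPTree n).size : ℝ) ^ (1 + Real.logb 2 ((c : ℝ) * n)) :=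
      Real.rpow_le_rpow_of_exponent_le (by linarith) (by linarith)
    rw [Real.rpow_two] at h5
    nlinarith
  · intro a b l r hl hr
    have hl' : (3 : ℝ) ≤ l.size := by exact_mod_cast hl
    have hr' : (3 : ℝ) ≤ r.size := by exact_mod_cast hr
    have hs : (l.size : ℝ) + r.size + (n + 2) ≤ ((SPTree.query a b l r).size : ℝ) := by
      exact_mod_cast SPTree.size_query_ge a b l r
    rcases le_total (l.size : ℝ) r.size with h | h
    · exact .inl (hstep _ _ _ hl' h hs)
    · exact .inr (hstep _ _ _ hr' h (by linarith))

theorem SPTree.numLeaves_pos {n : ℕ} (T : SPTree n) : 1 ≤ T.numLeaves := by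
  induction T with
  | leaf => simp [SPTree.numLeaves]
  | query a b l r ihl ihr => simp only [SPTree.numLeaves]; omega

theorem SPTree.refutableWithin_numLeaves {n c : ℕ} (hn : 1 ≤ n) (hc : 1 ≤ c) (hcn : 2 ≤ c * n)
    {T : SPTree n} {S : List (LinIneq n)} (hS : ContainsCube {I | I ∈ S}) (hT : T.Refutes S)
    (hTc : T.CoeffBound c) :
    RefutableWithin {I | I ∈ S}
      (18 * n * (T.numLeaves : ℝ) ^ (1 + Real.logb 2 ((c : ℝ) * n)) - 8 * n) := by
  have hm : (2 : ℝ) ≤ (c : ℝ) * n := by exact_mod_cast hcn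
  have hn' : (1 : ℝ) ≤ n := by exact_mod_cast hn
  have hstep : ∀ x y : ℝ, 1 ≤ x → x ≤ y →
      c * n * (3 / 2 * (18 * n * x ^ (1 + Real.logb 2 ((c : ℝ) * n)) - 8 * n) + 3) +
        (18 * n * y ^ (1 + Real.logb 2 ((c : ℝ) * n)) - 8 * n) + (2 * n + 6) ≤
      18 * n * (x + y) ^ (1 + Real.logb 2 ((c : ℝ) * n)) - 8 * n := by
    intro x y hx hxy
    -- The `-8 n` of the repeated side is multiplied to `-12 n * (c n)`, which outweighs `3 c n + 2
    -- n + 6`. A leaf keeps `10 n ≥ 2 (n + 2) + 4`.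
    have h1 := mul_le_mul_of_nonneg_left (rpow_branch_le hm (by linarith : 0 < x) hxy)
      (by positivity : (0 : ℝ) ≤ 18 * n)
    have h2 : (c : ℝ) * n ≤ c * n * n := le_mul_of_one_le_right (by positivity) hn'
    have h3 : 2 * (n : ℝ) ≤ c * n * n := mul_le_mul_of_nonneg_right hm (by positivity)
    linarith
  refine SPTree.refutableWithin hn hc
    (fun T => 18 * n * (T.numLeaves : ℝ) ^ (1 + Real.logb 2 ((c : ℝ) * n)) - 8 * n)
    ?_ ?_ T S hS hT hTc
  · intro S comb hS h
    obtain ⟨comb', h', hlen⟩ := h.exists_length_le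
    refine (h'.refutableWithin (hS ⟨0, hn⟩).1).mono ?_
    have h1 : (comb'.length : ℝ) ≤ n + 2 := by exact_mod_cast hlen
    simp only [SPTree.numLeaves, Nat.cast_one, Real.one_rpow]
    linarith
  · intro a b l r _ _
    have hl : (1 : ℝ) ≤ l.numLeaves := by exact_mod_cast l.numLeaves_pos
    have hr : (1 : ℝ) ≤ r.numLeaves := by exact_mod_cast r.numLeaves_pos
    simp only [SPTree.numLeaves, Nat.cast_add]
    rcases le_total (l.numLeaves : ℝ) r.numLeaves with h | h
    · exact .inl (hstep _ _ hl h)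
    · rw [add_comm (l.numLeaves : ℝ)]
      exact .inr (hstep _ _ hr h)

/-! ### A single variable -/

/-- The clauses falsified by `true` and by `false` are `¬x` and `x`, or one of them translates to `0
≥ 1` already. -/
theorem CNFFormula.exists_toIneq_of_unsatisfiable {F : CNFFormula 1} (hF : F.Unsatisfiable) :
    ∃ C ∈ F, ∃ D ∈ F, C.toIneq.IsLinComb D.toIneq (LinIneq.falsum 1) := by
  simp only [CNFFormula.Unsatisfiable, not_exists, not_forall] at hF
  obtain ⟨C, hC, hCv⟩ := hF fun _ => true
  obtain ⟨D, hD, hDv⟩ := hF fun _ => false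
  have hCpos : (0 : Fin 1) ∉ C.pos := fun h => hCv (.inl ⟨0, h, rfl⟩)
  have hDneg : (0 : Fin 1) ∉ D.neg := fun h => hDv (.inr ⟨0, h, rfl⟩)
  have hDn : D.neg = ∅ := Finset.eq_empty_of_forall_notMem fun i hi => hDneg (by
    rwa [Subsingleton.elim i 0] at hi)
  by_cases hCneg : (0 : Fin 1) ∈ C.neg
  · have hCn : C.neg = {0} := by
      ext i
      simp [Subsingleton.elim i 0, hCneg]
    by_cases hDpos : (0 : Fin 1) ∈ D.pos
    · refine ⟨C, hC, D, hD, 1, 1, ?_, ?_⟩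
      · intro i
        simp [Subsingleton.elim i 0, CNFClause.toIneq, LinIneq.falsum, hCpos, hCn, hDn, hDpos]
      · simp [CNFClause.toIneq, LinIneq.falsum, hCn, hDn]
    · refine ⟨C, hC, D, hD, 0, 1, ?_, ?_⟩
      · intro i
        simp [Subsingleton.elim i 0, CNFClause.toIneq, LinIneq.falsum, hDn, hDpos]
      · simp [CNFClause.toIneq, LinIneq.falsum, hDn]
  · have hCn : C.neg = ∅ := Finset.eq_empty_of_forall_notMem fun i hi => hCneg (by
      rwa [Subsingleton.elim i 0] at hi)
    refine ⟨C, hC, D, hD, 1, 0, ?_, ?_⟩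
    · intro i
      simp [Subsingleton.elim i 0, CNFClause.toIneq, LinIneq.falsum, hCpos, hCn]
    · simp [CNFClause.toIneq, LinIneq.falsum, hCn]

theorem CNFFormula.exists_refutation_length_three {F : CNFFormula 1} (hF : F.Unsatisfiable) :
    ∃ π, IsCPRefutation F.system π ∧ π.length = 3 := by
  obtain ⟨C, hC, D, hD, h⟩ := CNFFormula.exists_toIneq_of_unsatisfiable hF
  have hmem : ∀ E ∈ F, E.toIneq ∈ F.system := fun E hE =>
    List.mem_append_right _ (List.mem_map_of_mem hE)
  have h1 : CPExtends {I | I ∈ F.system} [] [LinIneq.falsum 1, D.toIneq, C.toIneq] 3 :=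
    ((CPExtends.refl.hyp (hmem C hC)).hyp (hmem D hD)).comb (by simp) (by simp) h
  exact ⟨_, ⟨h1.isCPProof_reverse, by simp⟩, by simp⟩

theorem theorem2 :
    ∃ K : ℕ, ∀ (n : ℕ), 1 ≤ n → ∀ (F : CNFFormula n), F.Unsatisfiable →
      ∀ (c : ℕ), 1 ≤ c → ∀ (T : SPTree n), T.Refutes F.system → T.CoeffBound c →
        ∃ π : List (LinIneq n), IsCPRefutation F.system π ∧
          (π.length : ℝ) ≤
            (T.size : ℝ) * ((c : ℝ) * (n : ℝ)) ^ (Real.logb 2 (T.size : ℝ)) ∧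
          (π.length : ℝ) ≤
            (K : ℝ) * (n : ℝ) *
              ((T.numLeaves : ℝ) * ((c : ℝ) * (n : ℝ)) ^ (Real.logb 2 (T.numLeaves : ℝ))) := by
  refine ⟨18, fun n hn F hF c hc T hT hTc => ?_⟩
  have hsize : (3 : ℝ) ≤ T.size := by exact_mod_cast T.three_le_size hT
  have hleaves : (1 : ℝ) ≤ T.numLeaves := by exact_mod_cast T.numLeaves_pos
  have hn' : (1 : ℝ) ≤ n := by exact_mod_cast hn
  by_cases hcn : 2 ≤ c * n
  · have hm : (0 : ℝ) < (c : ℝ) * n := by exact_mod_cast (by omega : 0 < c * n)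
    rw [mul_rpow_logb_two hm (by linarith), mul_rpow_logb_two hm (by linarith)]
    have hcube := F.containsCube_system
    obtain ⟨π₁, h₁, hlen₁⟩ :=
      (SPTree.refutableWithin_size hn hc hcn hcube hT hTc).exists_isCPRefutation
    obtain ⟨π₂, h₂, hlen₂⟩ :=
      ((SPTree.refutableWithin_numLeaves hn hc hcn hcube hT hTc).mono
        (by push_cast; linarith : _ ≤ ((18 : ℕ) : ℝ) * (n : ℝ) *
          (T.numLeaves : ℝ) ^ (1 + Real.logb 2 ((c : ℝ) * n)) - 1)).exists_isCPRefutation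
    -- The shorter of the two refutations meets both bounds.
    rcases le_total (π₁.length : ℝ) π₂.length with h | h
    · exact ⟨π₁, h₁, hlen₁, h.trans hlen₂⟩
    · exact ⟨π₂, h₂, h.trans hlen₁, hlen₂⟩
  · have hc1 : c = 1 := by nlinarith
    have hn1 : n = 1 := by nlinarith
    subst hc1 hn1
    obtain ⟨π, hπ, hlen⟩ := CNFFormula.exists_refutation_length_three hF
    refine ⟨π, hπ, ?_, ?_⟩
    · simpa [hlen] using hsize
    · simp only [hlen, Nat.cast_one, mul_one, Real.one_rpow]
      push_cast
      linarith
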